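/- **Theorem 3.** The model is the word-RAM with words of $w = \Omega(\log n)$ bits, and space is measured in words. For every constant $\varepsilon > 0$ there are a query program $P$ and constants $c_S, c_T, K$, all depending only on $\varepsilon$, such that the following holds for every tree $G$ on the nodes $0,\dots,n-1$, each of which is coloured black or white, and for every word length $w$ with $2^w \ge K n$. There is an index for $G$, consisting of at most $c_S\, n$ words of $w$ bits, such that for every non-empty multiset $M$ of colours the program $P$, given the index and the frequencies of black and white in $M$ (each less than $2^w$, so that it fits in a word), halts within $c_T\,|M|$ steps, leaves the index intact, and either * outputs the nodes, each listed once, of a connected (non-empty) subgraph $H$ of $G$ that is an approximate match of $M$: for each of the two colours, the frequency $h$ of the colour in $H$ and its frequency $m$ in $M$ satisfy $h \le (1+\varepsilon)\,m$ and $m \le (1+\varepsilon)\,h$; or * outputs nothing, and then $M$ has no exact match, i.e. no connected subgraph of $G$ has exactly $M$ as the multiset of its nodes' colours. In particular, whenever $M$ has an exact match, an approximate match of $M$ is found in $O(|M|)$ time. -/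

import Mathlib

/-! ## Coloured graphs, matches and approximate matches -/

/-- The two colours. -/
inductive Colour where
  | black
  | white
  deriving DecidableEq

/-- The multiset of the colours of the nodes in `S` (each node contributes its colour once). -/
def colourMultiset {V : Type*} (colour : V → Colour) (S : Finset V) : Multiset Colour :=
  S.val.map colour

/-- The node set `S` spans a (non-empty) connected subgraph of `G`. -/
def SpansConnected {V : Type*} (G : SimpleGraph V) (S : Finset V) : Prop :=
  (G.induce (S : Set V)).Connected

/-- `S` is the node set of a connected subgraph whose nodes' colours are exactly those in `M`. -/
def IsMatch {V : Type*} (G : SimpleGraph V) (colour : V → Colour) (M : Multiset Colour)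
    (S : Finset V) : Prop :=
  SpansConnected G S ∧ colourMultiset colour S = M

/-- The frequencies `a` and `b` differ by at most a factor of `1 + ε`, in either direction. In
particular `0` is within such a factor of `0` only. -/
def WithinFactor (ε : ℝ) (a b : ℕ) : Prop :=
  (a : ℝ) ≤ (1 + ε) * b ∧ (b : ℝ) ≤ (1 + ε) * a

/-- `S` is the node set of a connected subgraph in which the frequency of each colour is within
a factor of `1 + ε` of its frequency in `M`. -/
def IsApproxMatch {V : Type*} (G : SimpleGraph V) (colour : V → Colour) (ε : ℝ)
    (M : Multiset Colour) (S : Finset V) : Prop :=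
  SpansConnected G S ∧
    ∀ c : Colour, WithinFactor ε ((colourMultiset colour S).count c) (M.count c)

/-! ## The word RAM

A program is a fixed finite text, independent of the word length `w`. It works on registers that
hold `w`-bit words, on a random access memory of `2 ^ w` words that is addressed by words, and
on a write-only output list of words. Every operation costs one step. -/

namespace WordRAM

/-- Unit-cost binary operations on words. -/
inductive Op where
  | add | sub | mul | div | mod | and | or | xor | shl | shr | eq | lt

/-- Arithmetic is unsigned and modulo `2 ^ w`; comparisons return `1` or `0`. -/
def Op.eval {w : ℕ} : Op → BitVec w → BitVec w → BitVec w
  | .add, x, y => x + y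
  | .sub, x, y => x - y
  | .mul, x, y => x * y
  | .div, x, y => x / y
  | .mod, x, y => x % y
  | .and, x, y => x &&& y
  | .or, x, y => x ||| y
  | .xor, x, y => x ^^^ y
  | .shl, x, y => x <<< y
  | .shr, x, y => x >>> y
  | .eq, x, y => if x = y then 1#w else 0#w
  | .lt, x, y => if x.toNat < y.toNat then 1#w else 0#w

/-- Expressions: literals, registers, memory reads and binary operations. -/
inductive Expr where
  | lit (k : ℕ)
  | reg (r : ℕ)
  | load (addr : Expr)
  | bin (op : Op) (e₁ e₂ : Expr)

/-- Programs. -/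
inductive Prog where
  | nop
  | assign (r : ℕ) (e : Expr)
  | store (addr e : Expr)
  | emit (e : Expr)
  | seq (p q : Prog)
  | ite (e : Expr) (p q : Prog)
  | loop (e : Expr) (p : Prog)

/-- A state of the machine with `w`-bit words. -/
structure State (w : ℕ) where
  /-- the registers (a program mentions finitely many of them) -/
  reg : ℕ → BitVec w
  /-- the memory -/
  mem : BitVec w → BitVec w
  /-- the words output so far, in order -/
  out : List (BitVec w)

/-- The value of an expression. -/
def Expr.eval {w : ℕ} (s : State w) : Expr → BitVec w
  | .lit k => BitVec.ofNat w k
  | .reg r => s.reg r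
  | .load a => s.mem (a.eval s)
  | .bin op e₁ e₂ => op.eval (e₁.eval s) (e₂.eval s)

/-- The number of steps that it takes to evaluate an expression: one for each literal, register
access, memory access and operation in it. -/
def Expr.cost : Expr → ℕ
  | .lit _ => 1
  | .reg _ => 1
  | .load a => a.cost + 1
  | .bin _ e₁ e₂ => e₁.cost + e₂.cost + 1

/-- `Exec p s s' t`: started in state `s`, the program `p` halts after exactly `t` steps, in
state `s'`. Conditionals and loops test whether a word is non-zero. -/
inductive Exec {w : ℕ} : Prog → State w → State w → ℕ → Prop
  | nop (s : State w) : Exec .nop s s 1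
  | assign (r : ℕ) (e : Expr) (s : State w) :
      Exec (.assign r e) s { s with reg := Function.update s.reg r (e.eval s) } (e.cost + 1)
  | store (a e : Expr) (s : State w) :
      Exec (.store a e) s { s with mem := Function.update s.mem (a.eval s) (e.eval s) }
        (a.cost + e.cost + 1)
  | emit (e : Expr) (s : State w) :
      Exec (.emit e) s { s with out := s.out ++ [e.eval s] } (e.cost + 1)
  | seq {p q : Prog} {s₁ s₂ s₃ : State w} {t₁ t₂ : ℕ} (hp : Exec p s₁ s₂ t₁)
      (hq : Exec q s₂ s₃ t₂) : Exec (.seq p q) s₁ s₃ (t₁ + t₂)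
  | ite_true {e : Expr} {p q : Prog} {s s' : State w} {t : ℕ} (he : e.eval s ≠ 0#w)
      (hp : Exec p s s' t) : Exec (.ite e p q) s s' (e.cost + 1 + t)
  | ite_false {e : Expr} {p q : Prog} {s s' : State w} {t : ℕ} (he : e.eval s = 0#w)
      (hq : Exec q s s' t) : Exec (.ite e p q) s s' (e.cost + 1 + t)
  | loop_stop {e : Expr} {p : Prog} {s : State w} (he : e.eval s = 0#w) :
      Exec (.loop e p) s s (e.cost + 1)
  | loop_step {e : Expr} {p : Prog} {s₁ s₂ s₃ : State w} {t₁ t₂ : ℕ} (he : e.eval s₁ ≠ 0#w)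
      (hp : Exec p s₁ s₂ t₁) (hl : Exec (.loop e p) s₂ s₃ t₂) :
      Exec (.loop e p) s₁ s₃ (e.cost + 1 + t₁ + t₂)

/-- The memory `mem` contains the words of `I` in the cells `0, 1, …, I.length - 1`; the other
cells are arbitrary. -/
def Holds {w : ℕ} (I : List (BitVec w)) (mem : BitVec w → BitVec w) : Prop :=
  ∀ (i : ℕ) (hi : i < I.length), mem (BitVec.ofNat w i) = I[i]

end WordRAM

/-! ## Indexes and queries -/

/-- The output `out` of a query with multiset `M` is correct: it lists, without repetition, the
nodes of an approximate match, or else it is empty and `M` has no (exact) match. The name of a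
node `v : Fin n` is the word with value `v`. -/
def CorrectOutput {n w : ℕ} (G : SimpleGraph (Fin n)) (colour : Fin n → Colour) (ε : ℝ)
    (M : Multiset Colour) (out : List (BitVec w)) : Prop :=
  (∃ l : List (Fin n), l.Nodup ∧ out = l.map (fun v => BitVec.ofNat w v) ∧
      IsApproxMatch G colour ε M l.toFinset) ∨
    (out = [] ∧ ¬ ∃ S : Finset (Fin n), IsMatch G colour M S)

/-- With the index `I` in memory and the Parikh vector of `M` in registers `0` and `1` (the
other registers and memory cells being arbitrary), the program `P` halts within `T` steps with
correct output, and the index is again in memory, ready for the next query. -/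
def AnswersQuery {n w : ℕ} (P : WordRAM.Prog) (I : List (BitVec w)) (G : SimpleGraph (Fin n))
    (colour : Fin n → Colour) (ε : ℝ) (M : Multiset Colour) (T : ℕ) : Prop :=
  ∀ s : WordRAM.State w, WordRAM.Holds I s.mem →
    s.reg 0 = BitVec.ofNat w (M.count Colour.black) →
    s.reg 1 = BitVec.ofNat w (M.count Colour.white) →
    s.out = [] →
    ∃ (s' : WordRAM.State w) (t : ℕ), WordRAM.Exec P s s' t ∧ t ≤ T ∧
      WordRAM.Holds I s'.mem ∧ CorrectOutput G colour ε M s'.out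

/-! Only the minority colour `c` of `M` has to be met exactly. If a connected set has the right
number of nodes of colour `c` and its size is off by at most |M|/D, then the other colour, which
makes up at least half of `M`, is off by a factor of at most 1 + ε once D ≥ 2(1 + ε)/ε
(`withinFactor_of_scale`). So sizes are grouped into intervals [k, k + k/D], and for each interval
and colour it must be known which counts `m` of that colour occur, with a witness for each.

The witnesses are obtained by continuity. Among the connected sets with size in the interval, let
`A` and `B` have the extreme counts. In a tree there is a list that starts with `A`, ends with `B`,
and has connected windows in between (`SimpleGraph.IsTree.exists_isSlide`). Moving the window from
`A` to `B` changes the count by at most one per step, so every intermediate count occurs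
(`IsSlide.exists_window`).

The witnesses take little space. The list is `L₁ ++ P ++ L₂`, where `L₁` and `L₂` have O(k) nodes in
total and `P` is a path of arbitrary length. `P` is not stored: a piece of a path in a rooted tree
goes up and then down, so two starting nodes and two lengths recover it from one global parent table
(`List.exists_up_down`). Each witness is thus a record of eight words, and each interval costs O(k)
words. The values of k can be chosen with sum O(n) (`exists_scales`), so the index is linear. A
query looks up one record and prints O(|M|) nodes, at constant cost per node. -/

namespace SimpleGraph

/-! ### Growing connected sets; connected sets in trees -/

variable {V : Type*} {G : SimpleGraph V}

/-- Every entry of the list has a neighbour in `S` or among the entries before it. -/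
def AttachedTo (G : SimpleGraph V) : Set V → List V → Prop
  | _, [] => True
  | S, x :: l => (∃ s ∈ S, G.Adj s x) ∧ AttachedTo G (insert x S) l

theorem AttachedTo.mono {l : List V} : ∀ {S T : Set V}, S ⊆ T → AttachedTo G S l →
    AttachedTo G T l := by
  induction l with
  | nil => intros; trivial
  | cons x l ih =>
    rintro S T h ⟨⟨s, hs, hx⟩, hl⟩
    exact ⟨⟨s, h hs, hx⟩, ih (Set.insert_subset_insert h) hl⟩

theorem attachedTo_append {l l' : List V} : ∀ {S : Set V},
    AttachedTo G S (l ++ l') ↔ AttachedTo G S l ∧ AttachedTo G (S ∪ {x | x ∈ l}) l' := by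
  induction l with
  | nil => intro S; simp [AttachedTo]
  | cons x l ih =>
    intro S
    have : insert x S ∪ {y | y ∈ l} = S ∪ {y | y ∈ x :: l} := by
      ext y; simp; tauto
    simp only [List.cons_append, AttachedTo, ih, this, and_assoc]

theorem AttachedTo.take {S : Set V} {l : List V} (h : AttachedTo G S l) (i : ℕ) :
    AttachedTo G S (l.take i) := by
  rw [← List.take_append_drop i l, attachedTo_append] at h
  exact h.1

theorem AttachedTo.connected {l : List V} : ∀ {S : Set V}, (G.induce S).Connected →
    AttachedTo G S l → (G.induce (S ∪ {x | x ∈ l})).Connected := by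
  induction l with
  | nil =>
    intro S hS _
    have : S ∪ {x | x ∈ ([] : List V)} = S := by ext; simp
    rwa [this]
  | cons x l ih =>
    rintro S hS ⟨⟨s, hs, hx⟩, hl⟩
    have hc : (G.induce (insert x S)).Connected := by
      have := connected_induce_union (G := G) (t := {x}) hS.preconnected
        (by simp)
        hs rfl hx
      rwa [Set.union_singleton] at this
    have := ih hc hl
    have h2 : insert x S ∪ {y | y ∈ l} = S ∪ {y | y ∈ x :: l} := by
      ext y; simp; tauto
    rwa [h2] at this

theorem attachedTo_of_isChain {l : List V} : ∀ {S : Set V} {s : V}, s ∈ S →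
    (s :: l).IsChain G.Adj → AttachedTo G S l := by
  induction l with
  | nil => intros; trivial
  | cons x l ih =>
    intro S s hs h
    rw [List.isChain_cons_cons] at h
    exact ⟨⟨s, hs, h.1⟩, ih (Set.mem_insert _ _) h.2⟩

/-- As long as `C` is a proper subset of `A`, connectedness of `A` provides an edge within `A` that
leaves `C`; its far end is listed next and added to `C`. -/
theorem exists_attachedTo_enumeration [DecidableEq V] {A : Finset V}
    (hA : (G.induce (A : Set V)).Connected) {C : Finset V} (hC : C.Nonempty) (hCA : C ⊆ A) :
    ∃ l : List V, l.Nodup ∧ AttachedTo G C l ∧ ∀ x, x ∈ l ↔ x ∈ A ∧ x ∉ C := by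
  induction h : (A \ C).card generalizing C with
  | zero =>
    rw [Finset.card_eq_zero, Finset.sdiff_eq_empty_iff_subset] at h
    exact ⟨[], by simp, trivial, fun x => by simpa using @h x⟩
  | succ m ih =>
    obtain ⟨z, hz⟩ : (A \ C).Nonempty := by rw [← Finset.card_pos]; omega
    rw [Finset.mem_sdiff] at hz
    obtain ⟨c, hc⟩ := hC
    obtain ⟨x, y, hx, hy, hxy⟩ : ∃ x y, x ∈ C ∧ (y ∈ A ∧ y ∉ C) ∧ G.Adj x y := by
      by_contra hcon
      push Not at hcon
      obtain ⟨p⟩ := hA.preconnected ⟨c, hCA hc⟩ ⟨z, hz.1⟩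
      have : ∀ {u v : (A : Set V)} (_ : (G.induce (A : Set V)).Walk u v),
          u.1 ∈ C → v.1 ∈ C := by
        intro u v p
        induction p with
        | nil => exact id
        | @cons u v w hadj p ih =>
          intro hu
          apply ih
          by_contra hv
          exact hcon u.1 v.1 hu ⟨v.2, hv⟩ hadj
      exact hz.2 (this p hc)
    obtain ⟨l, hl, hat, hmem⟩ := ih (C := insert y C) (by simp)
      (Finset.insert_subset hy.1 hCA) (by
        rw [Finset.sdiff_insert, Finset.card_erase_of_mem (by simpa using hy), h]; rfl)
    refine ⟨y :: l, ?_, ⟨⟨x, hx, hxy⟩, by simpa using hat⟩, fun v => ?_⟩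
    · simp [hl, hmem]
    · have := hmem v
      simp only [List.mem_cons, this, Finset.mem_insert]
      by_cases hv : v = y <;> simp [hv, hy]

/-- The path between two common nodes is unique, so the one inside `A` and the one inside `B`
coincide and stay in the intersection. -/
theorem IsAcyclic.induce_inter_connected (hG : G.IsAcyclic) {A B : Set V}
    (hA : (G.induce A).Connected) (hB : (G.induce B).Connected) (hAB : (A ∩ B).Nonempty) :
    (G.induce (A ∩ B)).Connected := by
  classical
  have key : ∀ {S : Set V}, (G.induce S).Connected → ∀ u ∈ S, ∀ v ∈ S,
      ∃ p : G.Path u v, ∀ x ∈ p.1.support, x ∈ S := by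
    intro S hS u hu v hv
    obtain ⟨q⟩ := hS.preconnected ⟨u, hu⟩ ⟨v, hv⟩
    refine ⟨(q.map (Embedding.induce (G := G) S).toHom).toPath, fun x hx => ?_⟩
    have := Walk.support_toPath_subset_support _ hx
    have hx' : x ∈ q.support.map (Embedding.induce (G := G) S).toHom := by
      rw [← Walk.support_map]
      exact this
    obtain ⟨y, -, rfl⟩ := List.mem_map.1 hx'
    exact y.2
  rw [connected_iff]
  refine ⟨?_, hAB.to_subtype⟩
  rintro ⟨u, hu⟩ ⟨v, hv⟩
  obtain ⟨p, hp⟩ := key hA u hu.1 v hv.1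
  obtain ⟨q, hq⟩ := key hB u hu.2 v hv.2
  rw [(hG.subsingleton_path u v).elim q p] at hq
  exact ⟨p.1.induce (A ∩ B) fun x hx => ⟨hp x hx, hq x hx⟩⟩

/-- Fix a root and let the parent be the second node on the path to it. Of two adjacent nodes, one
lies on the path from the other to the root. -/
theorem IsTree.exists_parent (hG : G.IsTree) :
    ∃ par : V → V, ∀ u v, G.Adj u v → par u = v ∨ par v = u := by
  obtain ⟨r⟩ := hG.connected.nonempty
  choose p hp using fun v => (hG.existsUnique_path v r).exists
  refine ⟨fun v => (p v).snd, fun u v h => ?_⟩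
  by_cases hv : v ∈ (p u).support
  · exact Or.inl (hG.isAcyclic.eq_snd_of_adj_start (hp u) h hv).symm
  · refine Or.inr (hG.isAcyclic.eq_snd_of_adj_start (hp v) h.symm ?_).symm
    simpa using hG.isAcyclic.mem_support_of_ne_mem_support_of_adj_of_isPath (hp v).reverse
      (hp u).reverse h.symm (by simpa using hv)

end SimpleGraph

open SimpleGraph

/-! ### Paths: ascents, descents and crossings -/

theorem List.eq_iterate_of_isChain {α : Type*} {f : α → α} : ∀ {l : List α} {x : α},
    (x :: l).IsChain (fun a b => f a = b) → x :: l = List.iterate f x (l.length + 1) := by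
  intro l
  induction l with
  | nil => intros; rfl
  | cons y l ih =>
    intro x h
    rw [List.isChain_cons_cons] at h
    rw [List.iterate, h.1, ← List.length_cons.symm, ← ih h.2]

/-- Once a path has stepped down it cannot turn up again: the upward step would return to the node
just left. -/
theorem List.isChain_down {V : Type*} {G : SimpleGraph V} {par : V → V}
    (hpar : ∀ u v, G.Adj u v → par u = v ∨ par v = u) : ∀ {l : List V} {x y : V},
    (x :: y :: l).IsChain G.Adj → (x :: y :: l).Nodup → par y = x →
    (x :: y :: l).IsChain (fun a b => par b = a) := by
  intro l
  induction l with
  | nil => intro x y _ _ h; simpa using h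
  | cons z l ih =>
    intro x y hc hn h
    refine List.isChain_cons_cons.2
      ⟨h, ih (List.isChain_cons_cons.1 hc).2 (List.nodup_cons.1 hn).2 ?_⟩
    have hyz := (List.isChain_cons_cons.1 (List.isChain_cons_cons.1 hc).2).1
    refine (hpar y z hyz).resolve_left fun h2 => ?_
    have : x = z := h.symm.trans h2
    simp [this] at hn

/-- A path in a rooted tree goes up and then down. -/
theorem List.exists_up_down {V : Type*} [Nonempty V] {G : SimpleGraph V} {par : V → V}
    (hpar : ∀ u v, G.Adj u v → par u = v ∨ par v = u) {l : List V}
    (hc : l.IsChain G.Adj) (hn : l.Nodup) :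
    ∃ (u₁ : V) (n₁ : ℕ) (u₂ : V) (n₂ : ℕ),
      l = List.iterate par u₁ n₁ ++ (List.iterate par u₂ n₂).reverse := by
  have key : ∃ l₁ l₂, l = l₁ ++ l₂ ∧ l₁.IsChain (fun a b => par a = b) ∧
      l₂.reverse.IsChain (fun a b => par a = b) := by
    induction l with
    | nil => exact ⟨[], [], by simp⟩
    | cons x l ih =>
      cases l with
      | nil => exact ⟨[x], [], by simp⟩
      | cons y l =>
        obtain ⟨hxy, hc'⟩ := List.isChain_cons_cons.1 hc
        rcases hpar x y hxy with h | h
        · obtain ⟨l₁, l₂, he, h₁, h₂⟩ := ih hc' (List.nodup_cons.1 hn).2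
          refine ⟨x :: l₁, l₂, by simp [he], ?_, h₂⟩
          cases l₁ with
          | nil => simp
          | cons z l₁ =>
            obtain rfl : y = z := by simpa using congrArg List.head? he
            exact List.isChain_cons_cons.2 ⟨h, h₁⟩
        · exact ⟨[], x :: y :: l, by simp, by simp,
            List.isChain_reverse.2 (List.isChain_down hpar hc hn h)⟩
  obtain ⟨l₁, l₂, rfl, h₁, h₂⟩ := key
  have aux : ∀ l' : List V, l'.IsChain (fun a b => par a = b) →
      ∃ u n, l' = List.iterate par u n := by
    intro l' h
    cases l' with
    | nil => exact ⟨Classical.arbitrary V, 0, rfl⟩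
    | cons x l' => exact ⟨x, _, List.eq_iterate_of_isChain h⟩
  obtain ⟨u₁, n₁, e₁⟩ := aux _ h₁
  obtain ⟨u₂, n₂, e₂⟩ := aux _ h₂
  exact ⟨u₁, n₁, u₂, n₂, by rw [← e₁, ← e₂, List.reverse_reverse]⟩

/-- A shortest piece leading from `A` to `B` works: an interior node in `A` or `B` could replace one
of the two ends and shorten it. -/
theorem List.exists_crossing {V : Type*} (A B : Set V) (m : List V) :
    ∀ {l₁ l₂ : List V} {x y : V}, x ∈ A → y ∈ B →
    ∃ (l₃ l₄ P : List V) (a b : V), l₁ ++ x :: m ++ y :: l₂ = l₃ ++ (a :: P ++ [b]) ++ l₄ ∧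
      a ∈ A ∧ b ∈ B ∧ (∀ z ∈ P, z ∉ A ∧ z ∉ B) := by
  induction h : m.length using Nat.strong_induction_on generalizing m with
  | _ N ih =>
    intro l₁ l₂ x y hx hy
    by_cases hm : ∀ z ∈ m, z ∉ A ∧ z ∉ B
    · exact ⟨l₁, l₂, m, x, y, by simp, hx, hy, hm⟩
    · push Not at hm
      obtain ⟨z, hz, hzAB⟩ := hm
      obtain ⟨m₁, m₂, rfl⟩ := List.append_of_mem hz
      simp only [List.length_append, List.length_cons] at h
      by_cases hzA : z ∈ A
      · obtain ⟨l₃, l₄, P, a, b, he, hr⟩ := ih m₂.length (by omega) m₂ rfl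
          (l₁ := l₁ ++ x :: m₁) (l₂ := l₂) hzA hy
        exact ⟨l₃, l₄, P, a, b, by rw [← he]; simp, hr⟩
      · obtain ⟨l₃, l₄, P, a, b, he, hr⟩ := ih m₁.length (by omega) m₁ rfl
          (l₁ := l₁) (l₂ := m₂ ++ y :: l₂) hx (hzAB hzA)
        exact ⟨l₃, l₄, P, a, b, by rw [← he]; simp, hr⟩

/-! ### Sliding from one connected set to another -/

section Slide

variable {V : Type*} {G : SimpleGraph V}

theorem SimpleGraph.Connected.induce_congr {S T : Set V} (h : (G.induce S).Connected)
    (hST : ∀ x, x ∈ T ↔ x ∈ S) : (G.induce T).Connected := by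
  rwa [Set.ext hST]

/-- `L₁ ++ P ++ L₂` is an enumeration that starts with `A`, ends with `B`, and whose windows
between the two are all connected. -/
structure IsSlide [DecidableEq V] (G : SimpleGraph V) (A B : Finset V) (L₁ P L₂ : List V) :
    Prop where
  nodup : (L₁ ++ P ++ L₂).Nodup
  isChain : P.IsChain G.Adj
  length_le : L₁.length + L₂.length ≤ A.card + B.card
  card_left_le : A.card ≤ (L₁ ++ P ++ L₂).length
  card_right_le : B.card ≤ (L₁ ++ P ++ L₂).length
  take_eq : ((L₁ ++ P ++ L₂).take A.card).toFinset = A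
  drop_eq : ((L₁ ++ P ++ L₂).drop ((L₁ ++ P ++ L₂).length - B.card)).toFinset = B
  connected : ∀ l r, l + B.card ≤ (L₁ ++ P ++ L₂).length → A.card ≤ r → l < r →
    r ≤ (L₁ ++ P ++ L₂).length →
    (G.induce {x | x ∈ ((L₁ ++ P ++ L₂).take r).drop l}).Connected

theorem List.card_eq_of_nodup [DecidableEq V] {l : List V} {S : Finset V} (hl : l.Nodup)
    (h : ∀ x, x ∈ l ↔ x ∈ S) : l.length = S.card ∧ l.toFinset = S := by
  have : l.toFinset = S := by ext; simp [h]
  exact ⟨by rw [← this, List.toFinset_card_of_nodup hl], this⟩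

/-- The connected intersection is put in the middle, with the rest of `A` growing out of it to the
left and the rest of `B` to the right. No connecting path is needed. -/
theorem exists_isSlide_of_inter_nonempty [DecidableEq V] (hG : G.IsAcyclic) {A B : Finset V}
    (hA : (G.induce (A : Set V)).Connected) (hB : (G.induce (B : Set V)).Connected)
    (hAB : (A ∩ B).Nonempty) : ∃ L, IsSlide G A B L [] [] := by
  have hC : (G.induce ((A ∩ B : Finset V) : Set V)).Connected := by
    rw [Finset.coe_inter]
    exact hG.induce_inter_connected hA hB (by exact_mod_cast hAB)
  obtain ⟨α, hα, hαC, hαm⟩ := exists_attachedTo_enumeration hA hAB Finset.inter_subset_left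
  obtain ⟨β, hβ, hβC, hβm⟩ := exists_attachedTo_enumeration hB hAB Finset.inter_subset_right
  set γ := (A ∩ B).toList with hγ
  have hγm : ∀ x, x ∈ γ ↔ x ∈ A ∧ x ∈ B := by simp [hγ]
  have hγn : γ.Nodup := Finset.nodup_toList _
  have hn : (α.reverse ++ γ ++ β).Nodup := by
    simp only [List.nodup_append, List.nodup_reverse, hα, hβ, hγn, List.mem_append,
      List.mem_reverse, hαm, hβm, hγm, Finset.mem_inter]
    refine ⟨⟨trivial, trivial, ?_⟩, trivial, ?_⟩ <;> rintro a ha b hb rfl <;> tauto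
  obtain ⟨hAc, hAe⟩ := List.card_eq_of_nodup (l := α.reverse ++ γ) (S := A)
    (hn.sublist (List.sublist_append_left _ _)) (fun x => by
      simp only [List.mem_append, List.mem_reverse, hαm, hγm, Finset.mem_inter]; tauto)
  obtain ⟨hBc, hBe⟩ := List.card_eq_of_nodup (l := γ ++ β) (S := B)
    (hn.sublist (by rw [List.append_assoc]; exact List.sublist_append_right _ _)) (fun x => by
      simp only [List.mem_append, hβm, hγm, Finset.mem_inter]; tauto)
  simp only [List.length_append, List.length_reverse] at hAc hBc
  refine ⟨α.reverse ++ γ ++ β, ?_, ?_, ?_, ?_, ?_, ?_, ?_, ?_⟩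
  · simpa using hn
  · simp
  · simp; omega
  · simp; omega
  · simp; omega
  · rw [List.append_nil, List.append_nil, List.take_left' (by simp; omega), hAe]
  · rw [List.append_nil, List.append_nil, List.append_assoc,
      List.drop_left' (by simp; omega), hBe]
  · intro l r hl hr hlr hrn
    simp only [List.append_nil] at hl hrn ⊢
    simp only [List.length_append, List.length_reverse] at hl hrn
    -- The bounds on `l` and `r` say that the window contains all of `γ`, so it consists of `γ` with
    -- a prefix of `α` and a prefix of `β`, both attached to `γ`.
    have hw : ((α.reverse ++ γ ++ β).take r).drop l =
        (α.take (α.length - l)).reverse ++ (γ ++ β.take (r - A.card)) := by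
      rw [List.take_append, List.take_of_length_le (by simp; omega), List.append_assoc,
        List.drop_append_of_le_length (by simp; omega), List.drop_reverse]
      congr 4
      simp; omega
    have h₁ := AttachedTo.connected hC (hαC.take (α.length - l))
    have h₂ := AttachedTo.connected h₁ ((hβC.take (r - A.card)).mono Set.subset_union_left)
    refine h₂.induce_congr fun x => ?_
    rw [List.append_nil, List.append_nil, hw]
    simp [hγm]
    tauto

/-- A path from `a ∈ A` to `b ∈ B` with its interior outside both sets joins an enumeration of `A`
that grows leftwards from `a` to one of `B` that grows rightwards from `b`. -/
theorem exists_isSlide_of_disjoint [DecidableEq V] (hG : G.Connected) {A B : Finset V}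
    (hA : (G.induce (A : Set V)).Connected) (hB : (G.induce (B : Set V)).Connected)
    (hAB : Disjoint A B) : ∃ L₁ P L₂, IsSlide G A B L₁ P L₂ := by
  obtain ⟨x, hx⟩ := hA.nonempty
  obtain ⟨y, hy⟩ := hB.nonempty
  obtain ⟨p, hp⟩ := hG.exists_isPath x y
  have hxy : x ≠ y := fun h => Finset.disjoint_left.1 hAB hx (h ▸ hy)
  obtain ⟨l₃, l₄, P, a, b, he, ha, hb, hP⟩ : ∃ (l₃ l₄ P : List V) (a b : V),
      p.support = l₃ ++ (a :: P ++ [b]) ++ l₄ ∧ a ∈ (A : Set V) ∧ b ∈ (B : Set V) ∧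
      ∀ z ∈ P, z ∉ (A : Set V) ∧ z ∉ (B : Set V) := by
    have hs : ∃ m, p.support = [] ++ x :: m ++ y :: [] := by
      cases p with
      | nil => exact absurd rfl hxy
      | cons h q =>
        obtain ⟨m, hm⟩ : ∃ m, q.support = m ++ [y] :=
          ⟨q.support.dropLast, by
            conv_lhs => rw [← List.dropLast_append_getLast (Walk.support_ne_nil q)]
            simp⟩
        exact ⟨m, by simp [hm]⟩
    obtain ⟨m, hm⟩ := hs
    rw [hm]
    exact List.exists_crossing _ _ m hx hy
  have hchain : (a :: P ++ [b]).IsChain G.Adj :=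
    p.isChain_adj_support.infix ⟨l₃, l₄, he.symm⟩
  have hPn : P.Nodup := by
    have := hp.support_nodup
    rw [he] at this
    exact this.sublist (((List.sublist_append_left P [b]).cons a).trans
      ((List.sublist_append_right l₃ _).trans (List.sublist_append_left _ l₄)))
  obtain ⟨α, hα, hαC, hαm⟩ := exists_attachedTo_enumeration hA (Finset.singleton_nonempty a)
    (Finset.singleton_subset_iff.2 ha)
  obtain ⟨β, hβ, hβC, hβm⟩ := exists_attachedTo_enumeration hB (Finset.singleton_nonempty b)
    (Finset.singleton_subset_iff.2 hb)
  simp only [Finset.mem_singleton] at hαm hβm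
  simp only [Finset.coe_singleton] at hαC hβC
  rw [Finset.mem_coe] at ha hb
  simp only [Finset.mem_coe] at hP
  have hn₁ : (a :: α).Nodup := by simp [hα, hαm]
  have hn₂ : (b :: β).Nodup := by simp [hβ, hβm]
  have hm₁ : ∀ x, x ∈ a :: α ↔ x ∈ A := fun x => by
    by_cases h : x = a <;> simp [hαm, h, ha]
  have hm₂ : ∀ x, x ∈ b :: β ↔ x ∈ B := fun x => by
    by_cases h : x = b <;> simp [hβm, h, hb]
  obtain ⟨hAc, hAe⟩ := List.card_eq_of_nodup hn₁ hm₁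
  obtain ⟨hBc, hBe⟩ := List.card_eq_of_nodup hn₂ hm₂
  have hn : ((a :: α).reverse ++ P ++ (b :: β)).Nodup := by
    simp only [List.nodup_append, List.nodup_reverse, hn₁, hn₂, hPn, List.mem_append,
      List.mem_reverse, hm₁, hm₂]
    refine ⟨⟨trivial, trivial, ?_⟩, trivial, ?_⟩
    · rintro u hu v hv rfl
      exact (hP u hv).1 hu
    · rintro u hu v hv rfl
      rcases hu with hu | hu
      · exact Finset.disjoint_left.1 hAB hu hv
      · exact (hP u hu).2 hv
  refine ⟨(a :: α).reverse, P, b :: β, hn, ?_, ?_, ?_, ?_, ?_, ?_, ?_⟩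
  · exact hchain.infix ⟨[a], [b], by simp⟩
  · rw [List.length_reverse, hAc, hBc]
  · simp only [List.length_append, List.length_reverse, hAc, hBc]; omega
  · simp only [List.length_append, List.length_reverse, hAc, hBc]; omega
  · rw [List.append_assoc, List.take_left' (by rw [List.length_reverse, hAc]),
      List.toFinset_reverse, hAe]
  · rw [List.drop_left' (by
      simp only [List.length_append, List.length_reverse, hAc, hBc]; omega), hBe]
  · intro l r hl hr hlr hrn
    simp only [List.length_append, List.length_reverse, hAc, hBc] at hl hrn
    rw [List.append_assoc, List.take_append,
      List.take_of_length_le (by rw [List.length_reverse, hAc]; exact hr), List.length_reverse,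
      hAc]
    -- Either the window contains `a`, and it grows from `a` in both directions; or it starts on `P`
    -- or at `b`, because `l` is at most |A| + |P|, and it grows rightwards from its first node.
    by_cases hlA : l < A.card
    · rw [List.drop_append_of_le_length (by rw [List.length_reverse, hAc]; exact hlA.le),
        List.drop_reverse, hAc]
      obtain ⟨i, hi⟩ : ∃ i, A.card - l = i + 1 := ⟨A.card - l - 1, by omega⟩
      rw [hi, List.take_succ_cons]
      have h₁ := AttachedTo.connected (by simp) (hαC.take i)
      have hat : AttachedTo G {a} (P ++ (b :: β)) := by
        have h₂ := attachedTo_of_isChain (Set.mem_singleton a) hchain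
        rw [← List.singleton_append, ← List.append_assoc, attachedTo_append]
        exact ⟨h₂, hβC.mono (by simp)⟩
      have h₃ := AttachedTo.connected h₁ ((hat.take (r - A.card)).mono Set.subset_union_left)
      refine h₃.induce_congr fun x => ?_
      simp
      tauto
    · obtain ⟨j, rfl⟩ : ∃ j, l = A.card + j := ⟨l - A.card, by omega⟩
      rw [List.drop_append, List.drop_of_length_le (by rw [List.length_reverse, hAc]; omega),
        List.length_reverse, hAc, List.nil_append, Nat.add_sub_cancel_left, List.drop_take,
        List.drop_append_of_le_length (by omega)]
      have hch : (P.drop j ++ [b]).IsChain G.Adj := by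
        refine hchain.infix ⟨a :: P.take j, [], ?_⟩
        simp
        rw [← List.append_assoc, List.take_append_drop]
      obtain ⟨x, q, hxq⟩ : ∃ x q, P.drop j ++ [b] = x :: q := by
        rcases h : P.drop j ++ [b] with _ | ⟨x, q⟩
        · simp at h
        · exact ⟨x, q, rfl⟩
      have hbq : b ∈ x :: q := by rw [← hxq]; simp
      rw [← List.singleton_append (l := β), ← List.append_assoc, hxq]
      rw [hxq] at hch
      obtain ⟨i, hi⟩ : ∃ i, r - A.card - j = i + 1 := ⟨r - A.card - j - 1, by omega⟩
      rw [hi, List.cons_append, List.take_succ_cons]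
      have hat : AttachedTo G {x} (q ++ β) := by
        rw [attachedTo_append]
        exact ⟨attachedTo_of_isChain (Set.mem_singleton x) hch,
          hβC.mono (by simpa using hbq)⟩
      have h₁ := AttachedTo.connected (by simp) (hat.take i)
      refine h₁.induce_congr fun y => ?_
      simp

theorem SimpleGraph.IsTree.exists_isSlide [DecidableEq V] (hG : G.IsTree) {A B : Finset V}
    (hA : (G.induce (A : Set V)).Connected) (hB : (G.induce (B : Set V)).Connected) :
    ∃ L₁ P L₂, IsSlide G A B L₁ P L₂ := by
  by_cases h : Disjoint A B
  · exact exists_isSlide_of_disjoint hG.connected hA hB h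
  · obtain ⟨L, hL⟩ := exists_isSlide_of_inter_nonempty hG.isAcyclic hA hB
      (Finset.not_disjoint_iff_nonempty_inter.1 h)
    exact ⟨L, [], [], hL⟩

/-- Discrete intermediate value theorem, to be applied to the colour count of a moving window. -/
theorem exists_eq_of_step_le_one {g : ℕ → ℤ} {T : ℕ} {w : ℤ}
    (hg : ∀ t < T, |g (t + 1) - g t| ≤ 1) (hw : w ∈ Set.uIcc (g 0) (g T)) : ∃ t ≤ T, g t = w := by
  induction T with
  | zero => exact ⟨0, le_rfl, by simpa [eq_comm] using hw⟩
  | succ T ih =>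
    by_cases h : w ∈ Set.uIcc (g 0) (g T)
    · obtain ⟨t, ht, e⟩ := ih (fun t ht => hg t (by omega)) h
      exact ⟨t, by omega, e⟩
    · refine ⟨T + 1, le_rfl, ?_⟩
      have := hg T (by omega)
      rw [abs_le] at this
      rw [Set.mem_uIcc] at hw h
      omega

theorem count_colourMultiset_toFinset [DecidableEq V] (colour : V → Colour) (c : Colour)
    {l : List V} (hl : l.Nodup) :
    (colourMultiset colour l.toFinset).count c = (l.map colour).count c := by
  rw [colourMultiset, List.toFinset_val, List.dedup_eq_self.2 hl]
  simp

theorem List.exists_window_append {α : Type*} (a b : List α) (l r : ℕ) :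
    ∃ a' b', ((a ++ b).take r).drop l = a' ++ b' ∧ a' <:+: a ∧ b' <:+: b := by
  rw [List.take_append, List.drop_append]
  exact ⟨_, _, rfl, (List.drop_suffix _ _).isInfix.trans (List.take_prefix _ _).isInfix,
    (List.drop_suffix _ _).isInfix.trans (List.take_prefix _ _).isInfix⟩

theorem List.IsInfix.exists_append {α : Type*} {a b w : List α} (h : w <:+: a ++ b) :
    ∃ a' b', w = a' ++ b' ∧ a' <:+: a ∧ b' <:+: b := by
  obtain ⟨s, t, h⟩ := h
  obtain ⟨a', b', he, h'⟩ := List.exists_window_append a b s.length (s ++ w).length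
  refine ⟨a', b', ?_, h'⟩
  rw [← he, ← h, List.take_left, List.drop_left]

/-- In a slide from `A` to `B`, every count between those of `A` and `B` occurs in a window whose
size is between those of `A` and `B`. -/
theorem IsSlide.exists_window [DecidableEq V] {A B : Finset V} {L₁ P L₂ : List V}
    (h : IsSlide G A B L₁ P L₂) (hA : A.Nonempty) (hAB : A.card ≤ B.card) (colour : V → Colour)
    (c : Colour) {m : ℕ}
    (hm : (m : ℤ) ∈ Set.uIcc ((colourMultiset colour A).count c : ℤ)
      ((colourMultiset colour B).count c)) :
    ∃ o : List V, o <:+: L₁ ++ P ++ L₂ ∧ (G.induce {x | x ∈ o}).Connected ∧ A.card ≤ o.length ∧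
      o.length ≤ B.card ∧ (o.map colour).count c = m := by
  set y := L₁ ++ P ++ L₂ with hy
  set N := y.length with hN
  set a := A.card with ha
  set b := B.card with hb
  have hab := h.card_left_le
  have hbN := h.card_right_le
  rw [← hy] at hab hbN
  have hpos : 0 < a := hA.card_pos
  -- Prefix counts: a window's count is a difference of two values of `F`.
  set F : ℕ → ℤ := fun i => (((y.take i).map colour).count c : ℕ) with hF
  have hstep : ∀ i, F i ≤ F (i + 1) ∧ F (i + 1) ≤ F i + 1 := by
    intro i
    simp only [hF]
    rw [List.take_add_one, List.map_append, List.count_append]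
    have : List.count c (List.map colour y[i]?.toList) ≤ 1 := by
      refine List.count_le_length.trans ?_
      rw [List.length_map]
      cases y[i]? <;> simp
    omega
  have hwin : ∀ l r, l ≤ r → ((((y.take r).drop l).map colour).count c : ℤ) = F r - F l := by
    intro l r hlr
    have : y.take r = y.take l ++ (y.take r).drop l := by
      conv_lhs => rw [← List.take_append_drop l (y.take r), List.take_take, min_eq_left hlr]
    simp only [hF]
    conv_rhs => rw [this]
    rw [List.map_append, List.count_append]
    push_cast
    ring
  have hFA : F a - F 0 = (colourMultiset colour A).count c := by
    rw [← hwin 0 a (by omega), List.drop_zero,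
      ← count_colourMultiset_toFinset colour c (h.nodup.sublist (List.take_sublist _ _)),
      h.take_eq]
  have hFB : F N - F (N - b) = (colourMultiset colour B).count c := by
    rw [← hwin (N - b) N (by omega), List.take_length,
      ← count_colourMultiset_toFinset colour c (h.nodup.sublist (List.drop_sublist _ _)),
      h.drop_eq]
  -- At time `t` the window is [min t (N - b), a + t). Both ends advance together until the left end
  -- reaches the start of `B`; from then on only the right end moves, so the size grows from `a` to
  -- `b`. A step gains at most one node and loses at most one.
  obtain ⟨t, ht, hgt⟩ := exists_eq_of_step_le_one
    (g := fun t => F (a + t) - F (min t (N - b))) (T := N - a) (w := m) (by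
      intro t ht
      have h₁ := hstep (a + t)
      have h₂ := hstep t
      rw [← add_assoc, abs_le]
      by_cases h : t < N - b
      · rw [min_eq_left (by omega), min_eq_left (by omega)]
        omega
      · rw [min_eq_right (by omega), min_eq_right (by omega)]
        omega) (by
      rw [min_eq_right (by omega : N - b ≤ N - a), Nat.add_sub_cancel' hab, hFB, add_zero,
        Nat.zero_min, hFA]
      exact hm)
  refine ⟨(y.take (a + t)).drop (min t (N - b)),
    (List.drop_suffix _ _).isInfix.trans (List.take_prefix _ _).isInfix,
    h.connected _ _ ?_ ?_ ?_ ?_, ?_, ?_, ?_⟩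
  · rw [← hy, ← hN]; omega
  · omega
  · omega
  · rw [← hy, ← hN]; omega
  · rw [List.length_drop, List.length_take]; omega
  · rw [List.length_drop, List.length_take]; omega
  · have := hwin (min t (N - b)) (a + t) (by omega)
    omega

/-- One short list `L` serves all counts: a window of the slide between the two extreme sets meets
`L₁` and `L₂` in infixes of `L = L₁ ++ L₂`, and meets `P` in a path that two ancestor sequences
describe. -/
theorem SimpleGraph.IsTree.exists_window_list [Fintype V] [DecidableEq V] (hG : G.IsTree)
    {par : V → V} (hpar : ∀ u v, G.Adj u v → par u = v ∨ par v = u) (colour : V → Colour)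
    (c : Colour) (k k' : ℕ) :
    ∃ L : List V, L.length ≤ 2 * k' ∧ ∀ S : Finset V, SpansConnected G S → k ≤ S.card →
      S.card ≤ k' → ∃ (l₁ l₂ : List V) (u₁ : V) (n₁ : ℕ) (u₂ : V) (n₂ : ℕ),
        l₁ <:+: L ∧ l₂ <:+: L ∧
        (l₁ ++ List.iterate par u₁ n₁ ++ List.iterate par u₂ n₂ ++ l₂).Nodup ∧
        SpansConnected G
          (l₁ ++ List.iterate par u₁ n₁ ++ List.iterate par u₂ n₂ ++ l₂).toFinset ∧
        k ≤ (l₁ ++ List.iterate par u₁ n₁ ++ List.iterate par u₂ n₂ ++ l₂).length ∧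
        (l₁ ++ List.iterate par u₁ n₁ ++ List.iterate par u₂ n₂ ++ l₂).length ≤ k' ∧
        ((l₁ ++ List.iterate par u₁ n₁ ++ List.iterate par u₂ n₂ ++ l₂).map colour).count c =
          (colourMultiset colour S).count c := by
  classical
  have := hG.connected.nonempty
  let F : Finset (Finset V) := Finset.univ.filter fun S =>
    SpansConnected G S ∧ k ≤ S.card ∧ S.card ≤ k'
  by_cases hF : F.Nonempty
  swap
  · refine ⟨[], by simp, fun S h₁ h₂ h₃ => (hF ⟨S, ?_⟩).elim⟩
    simp [F, h₁, h₂, h₃]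
  let cnt : Finset V → ℕ := fun S => (colourMultiset colour S).count c
  obtain ⟨A, hAF, hA⟩ := F.exists_min_image cnt hF
  obtain ⟨B, hBF, hB⟩ := F.exists_max_image cnt hF
  -- The window grows along the slide, so the smaller of the two extreme sets comes first, whichever
  -- of them has the larger count.
  obtain ⟨A, B, hAF, hBF, hcard, hAB⟩ : ∃ A B, A ∈ F ∧ B ∈ F ∧ A.card ≤ B.card ∧
      ∀ S ∈ F, (cnt S : ℤ) ∈ Set.uIcc (cnt A : ℤ) (cnt B) := by
    rcases le_total A.card B.card with h | h
    · exact ⟨A, B, hAF, hBF, h, fun S hS => Set.mem_uIcc_of_le (by exact_mod_cast hA S hS)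
        (by exact_mod_cast hB S hS)⟩
    · exact ⟨B, A, hBF, hAF, h, fun S hS => Set.mem_uIcc_of_ge (by exact_mod_cast hA S hS)
        (by exact_mod_cast hB S hS)⟩
  simp only [F, Finset.mem_filter, Finset.mem_univ, true_and] at hAF hBF hAB
  obtain ⟨L₁, P, L₂, hs⟩ := hG.exists_isSlide hAF.1 hBF.1
  refine ⟨L₁ ++ L₂, ?_, fun S h₁ h₂ h₃ => ?_⟩
  · have := hs.length_le
    rw [List.length_append]
    omega
  obtain ⟨o, hoi, hoc, hol, hou, hom⟩ := hs.exists_window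
    (by obtain ⟨x⟩ := hAF.1.nonempty; exact ⟨x, x.2⟩) hcard colour c (hAB S ⟨h₁, h₂, h₃⟩)
  have hon := hs.nodup.sublist hoi.sublist
  obtain ⟨q, l₂, rfl, hq, hl₂⟩ := hoi.exists_append
  obtain ⟨l₁, p, rfl, hl₁, hp⟩ := hq.exists_append
  obtain ⟨u₁, n₁, u₂, n₂, rfl⟩ := List.exists_up_down hpar (hs.isChain.infix hp)
    (((hs.nodup.sublist (List.sublist_append_left _ _)).sublist
      (List.sublist_append_right _ _)).sublist hp.sublist)
  -- The descending half is listed backwards, as an ascent from its lower end. Only the set of nodes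
  -- matters.
  have hperm : List.Perm (l₁ ++ List.iterate par u₁ n₁ ++ List.iterate par u₂ n₂ ++ l₂)
      (l₁ ++ (List.iterate par u₁ n₁ ++ (List.iterate par u₂ n₂).reverse) ++ l₂) := by
    rw [List.append_assoc l₁]
    exact (((List.reverse_perm _).symm.append_left _).append_left _).append_right _
  refine ⟨l₁, l₂, u₁, n₁, u₂, n₂, hl₁.trans (List.prefix_append _ _).isInfix,
    hl₂.trans (List.suffix_append _ _).isInfix, hperm.nodup_iff.2 hon, ?_, ?_, ?_, ?_⟩
  · refine hoc.induce_congr fun x => ?_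
    rw [Finset.mem_coe, List.mem_toFinset, hperm.mem_iff]
    rfl
  · rw [hperm.length_eq]; omega
  · rw [hperm.length_eq]; omega
  · rw [(hperm.map colour).count_eq]
    exact hom

end Slide

/-! ### Layout and size of the index -/

/-- The list `l` is stored in `J` from position `p` on. -/
def StoredAt (J : List ℕ) (p : ℕ) (l : List ℕ) : Prop :=
  ∀ (i : ℕ) (_ : i < l.length), J[p + i]? = l[i]?

theorem StoredAt.append {J l : List ℕ} {p : ℕ} (h : StoredAt J p l) (s t : List ℕ) :
    StoredAt (s ++ J ++ t) (s.length + p) l := by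
  intro i hi
  have h' := h i hi
  have hl : l[i]? = some l[i] := List.getElem?_eq_getElem hi
  have hlt : p + i < J.length := by
    by_contra hcon
    rw [List.getElem?_eq_none (by omega), hl] at h'
    exact absurd h' (by simp)
  rw [List.append_assoc, List.getElem?_append_right (by omega),
    List.getElem?_append_left (by omega), ← h']
  congr 1
  omega

theorem storedAt_of_append (s l t : List ℕ) : StoredAt (s ++ l ++ t) s.length l := by
  have : StoredAt l 0 l := fun i _ => by rw [zero_add]
  exact this.append s t

section Index

variable {n : ℕ} {G : SimpleGraph (Fin n)}

/-- The eight words in `J` at `base + 8 * m` describe the list `o` of nodes: a segment of `J`, two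
sequences of ancestors, and another segment of `J`. -/
def RecordAt (par : Fin n → Fin n) (J : List ℕ) (base m : ℕ) (o : List (Fin n)) : Prop :=
  ∃ (p₁ : ℕ) (l₁ : List (Fin n)) (u₁ : Fin n) (n₁ : ℕ) (u₂ : Fin n) (n₂ p₂ : ℕ)
    (l₂ : List (Fin n)),
    StoredAt J (base + 8 * m)
      [p₁, l₁.length, (u₁ : ℕ), n₁, (u₂ : ℕ), n₂, p₂, l₂.length] ∧
    StoredAt J (base + p₁) (l₁.map Fin.val) ∧ StoredAt J (base + p₂) (l₂.map Fin.val) ∧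
    o = l₁ ++ List.iterate par u₁ n₁ ++ List.iterate par u₂ n₂ ++ l₂

theorem RecordAt.append {par : Fin n → Fin n} {J : List ℕ} {base m : ℕ} {o : List (Fin n)}
    (h : RecordAt par J base m o) (s t : List ℕ) :
    RecordAt par (s ++ J ++ t) (s.length + base) m o := by
  obtain ⟨p₁, l₁, u₁, n₁, u₂, n₂, p₂, l₂, h, h₁, h₂, ho⟩ := h
  refine ⟨p₁, l₁, u₁, n₁, u₂, n₂, p₂, l₂, ?_, ?_, ?_, ho⟩
  · rw [add_assoc]; exact h.append s t
  · rw [add_assoc]; exact h₁.append s t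
  · rw [add_assoc]; exact h₂.append s t

/-- `o` lists a connected set with between `k` and `k'` nodes of which `m` have the colour `c`,
or else it is empty and there is no such set. -/
def IsAnswer (G : SimpleGraph (Fin n)) (colour : Fin n → Colour) (c : Colour) (k k' m : ℕ)
    (o : List (Fin n)) : Prop :=
  (o = [] ∧ ∀ S : Finset (Fin n), SpansConnected G S → k ≤ S.card → S.card ≤ k' →
    (colourMultiset colour S).count c ≠ m) ∨
  (o.Nodup ∧ SpansConnected G o.toFinset ∧ k ≤ o.length ∧ o.length ≤ k' ∧
    (o.map colour).count c = m)

theorem IsAnswer.length_le {colour : Fin n → Colour} {c : Colour} {k k' m : ℕ}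
    {o : List (Fin n)} (h : IsAnswer G colour c k k' m o) : o.length ≤ k' := by
  rcases h with ⟨rfl, -⟩ | h
  · simp
  · exact h.2.2.2.1

/-- A block is a table of `k' + 1` records of eight words, one for each count, followed by the
common list of at most `2 * k'` nodes into which the records point. -/
theorem exists_block (hG : G.IsTree) {par : Fin n → Fin n}
    (hpar : ∀ u v, G.Adj u v → par u = v ∨ par v = u) (colour : Fin n → Colour) (c : Colour)
    (k k' : ℕ) :
    ∃ J : List ℕ, J.length ≤ 10 * k' + 8 ∧
      ∀ m ≤ k', ∃ o, RecordAt par J 0 m o ∧ IsAnswer G colour c k k' m o := by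
  obtain ⟨L, hL, hS⟩ := hG.exists_window_list hpar colour c k k'
  obtain ⟨v₀⟩ := hG.connected.nonempty
  have hrec : ∀ m : ℕ, ∃ (x₁ l₁ z₁ x₂ l₂ z₂ : List (Fin n)) (u₁ : Fin n) (n₁ : ℕ) (u₂ : Fin n)
      (n₂ : ℕ), L = x₁ ++ l₁ ++ z₁ ∧ L = x₂ ++ l₂ ++ z₂ ∧
        IsAnswer G colour c k k' m
          (l₁ ++ List.iterate par u₁ n₁ ++ List.iterate par u₂ n₂ ++ l₂) := by
    intro m
    by_cases h : ∃ S : Finset (Fin n), SpansConnected G S ∧ k ≤ S.card ∧ S.card ≤ k' ∧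
        (colourMultiset colour S).count c = m
    · obtain ⟨S, h₁, h₂, h₃, rfl⟩ := h
      obtain ⟨l₁, l₂, u₁, n₁, u₂, n₂, ⟨x₁, z₁, e₁⟩, ⟨x₂, z₂, e₂⟩, ho⟩ := hS S h₁ h₂ h₃
      exact ⟨x₁, l₁, z₁, x₂, l₂, z₂, u₁, n₁, u₂, n₂, e₁.symm, e₂.symm, Or.inr ho⟩
    · push Not at h
      -- For a count that does not occur the record describes the empty list; `v₀` is a dummy, as
      -- both ancestor sequences have length 0.
      exact ⟨[], [], L, [], [], L, v₀, 0, v₀, 0, rfl, rfl, Or.inl ⟨rfl, h⟩⟩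
  choose x₁ l₁ z₁ x₂ l₂ z₂ u₁ n₁ u₂ n₂ e₁ e₂ hans using hrec
  set A := 8 * (k' + 1) with hA
  let rec' : ℕ → List ℕ := fun m => [A + (x₁ m).length, (l₁ m).length, u₁ m, n₁ m, u₂ m, n₂ m,
    A + (x₂ m).length, (l₂ m).length]
  let R : List ℕ := (List.range A).map fun i => (rec' (i / 8)).getD (i % 8) 0
  have hR : R.length = A := by simp [R]
  refine ⟨R ++ L.map Fin.val, ?_, fun m hm => ⟨_, ⟨A + (x₁ m).length, l₁ m, u₁ m, n₁ m, u₂ m,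
    n₂ m, A + (x₂ m).length, l₂ m, ?_, ?_, ?_, rfl⟩, hans m⟩⟩
  · simp only [List.length_append, hR, List.length_map]
    omega
  · change StoredAt _ _ (rec' m)
    intro i hi
    have hi8 : i < 8 := hi
    rw [List.getElem?_append_left (by omega), List.getElem?_map, List.getElem?_range (by omega),
      Option.map_some, show (0 + 8 * m + i) / 8 = m by omega,
      show (0 + 8 * m + i) % 8 = i by omega, List.getD_eq_getElem _ _ hi,
      List.getElem?_eq_getElem hi]
  · have := storedAt_of_append (R ++ (x₁ m).map Fin.val) ((l₁ m).map Fin.val)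
      ((z₁ m).map Fin.val)
    rw [List.length_append, hR, List.length_map] at this
    rw [zero_add]
    convert this using 1
    conv_lhs => rw [e₁ m]
    simp
  · have := storedAt_of_append (R ++ (x₂ m).map Fin.val) ((l₂ m).map Fin.val)
      ((z₂ m).map Fin.val)
    rw [List.length_append, hR, List.length_map] at this
    rw [zero_add]
    convert this using 1
    conv_lhs => rw [e₂ m]
    simp

/-- The intervals `[k, k + k / D]` for suitable `k` with a small sum cover `[1, n]`. -/
theorem exists_scales (D n : ℕ) (hD : 0 < D) : ∃ ks : List ℕ, (∀ k ∈ ks, 1 ≤ k ∧ k ≤ n) ∧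
    ks.sum ≤ (D + 1) * n ∧ ∀ s, 1 ≤ s → s ≤ n → ∃ k ∈ ks, k ≤ s ∧ s ≤ k + k / D := by
  induction n using Nat.strong_induction_on with
  | _ n ih =>
    rcases Nat.eq_zero_or_pos n with rfl | hn
    · exact ⟨[], by simp, by simp, fun s h₁ h₂ => by omega⟩
    -- `q` is the largest integer with q ≤ (n - q)/D, so the scale k = n - q covers everything from
    -- k to n; the induction covers the sizes below k. Maximality of `q` gives n < (D + 1)(q + 1),
    -- which pays for k in the sum.
    set q := n / (D + 1) with hq
    have hq₁ : (D + 1) * q ≤ n := Nat.mul_div_le _ _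
    have hq₂ : n < (D + 1) * (q + 1) := Nat.lt_mul_div_succ n (by omega)
    have hq₃ : q < n := Nat.div_lt_self hn (by omega)
    clear_value q
    clear hq
    obtain ⟨k, hk⟩ : ∃ k, n = k + q ∧ 1 ≤ k := ⟨n - q, by omega, by omega⟩
    obtain ⟨ks, h₁, h₂, h₃⟩ := ih (k - 1) (by omega)
    refine ⟨k :: ks, ?_, ?_, ?_⟩
    · intro j hj
      rcases List.mem_cons.1 hj with rfl | hj
      · omega
      · have := h₁ j hj
        omega
    · rw [List.sum_cons]
      obtain ⟨k, rfl⟩ : ∃ j, k = j + 1 := ⟨k - 1, by omega⟩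
      rw [Nat.add_sub_cancel] at h₂
      have hk' := hk.1
      nlinarith
    · intro s hs₁ hs₂
      by_cases hs : s ≤ k - 1
      · obtain ⟨j, hj, h⟩ := h₃ s hs₁ hs
        exact ⟨j, List.mem_cons_of_mem _ hj, h⟩
      · refine ⟨k, List.mem_cons_self, by omega, ?_⟩
        have : q ≤ k / D := by
          rw [Nat.le_div_iff_mul_le hD]
          have hk' := hk.1
          nlinarith
        omega

/-- The position in the index of the entry with number `s` of the directory for `c`. -/
def directoryEntry (n : ℕ) (c : Colour) (s : ℕ) : ℕ :=
  match c with
  | .white => n + s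
  | .black => n + n + s

/-- The index consists of `n`, the parent table, the directory for white, the directory for black,
and the blocks. Entry `s` of a directory points to a block whose interval contains `s`. -/
theorem exists_index (hG : G.IsTree) (colour : Fin n → Colour) (D : ℕ) (hD : 0 < D) :
    ∃ (par : Fin n → Fin n) (J : List ℕ), J.length ≤ (56 * D + 60) * n ∧
      J[0]? = some n ∧
      (∀ v : Fin n, J[(v : ℕ) + 1]? = some (par v : ℕ)) ∧
      ∀ s, 1 ≤ s → s ≤ n → ∀ c : Colour, ∀ m ≤ s, ∃ base k o,
        J[directoryEntry n c s]? = some base ∧ 1 ≤ k ∧ k ≤ s ∧ s ≤ k + k / D ∧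
        RecordAt par J base m o ∧ IsAnswer G colour c k (k + k / D) m o := by
  obtain ⟨par, hpar⟩ := hG.exists_parent
  obtain ⟨ks, hks, hsum, hcov⟩ := exists_scales D n hD
  have hn : 0 < n := by
    obtain ⟨v⟩ := hG.connected.nonempty
    exact v.pos
  choose blk hlen hrec using fun c k => exists_block hG hpar colour c k (k + k / D)
  set T : List (List ℕ) := ks.flatMap fun k => [blk .white k, blk .black k] with hT
  -- With k' ≤ 2k and k ≥ 1 a block has at most 10k' + 8 ≤ 28k words, and there are two colours.
  have hTlen : T.flatten.length ≤ 56 * ks.sum := by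
    rw [hT]
    clear hsum hcov hT
    clear_value T
    induction ks with
    | nil => simp
    | cons k ks ih =>
      have h₁ := hlen .white k
      have h₂ := hlen .black k
      have h₃ := Nat.div_le_self k D
      have h₄ := hks k List.mem_cons_self
      have h₅ := ih fun j hj => hks j (List.mem_cons_of_mem _ hj)
      simp only [List.flatMap_cons, List.flatten_append, List.length_append, List.sum_cons,
        List.flatten_cons, List.flatten_nil, List.length_nil] at h₅ ⊢
      omega
  have hloc : ∀ s, ∃ k, 1 ≤ s → s ≤ n → k ∈ ks ∧ k ≤ s ∧ s ≤ k + k / D := by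
    intro s
    by_cases h : 1 ≤ s ∧ s ≤ n
    · obtain ⟨k, hk⟩ := hcov s h.1 h.2
      exact ⟨k, fun _ _ => hk⟩
    · exact ⟨0, fun h₁ h₂ => (h ⟨h₁, h₂⟩).elim⟩
  choose κ hκ using hloc
  have hpos : ∀ (c : Colour) (k : ℕ), ∃ x z : List ℕ, k ∈ ks → T.flatten = x ++ blk c k ++ z := by
    intro c k
    by_cases hk : k ∈ ks
    · have : blk c k ∈ T := by
        rw [hT, List.mem_flatMap]
        exact ⟨k, hk, by cases c <;> simp⟩
      obtain ⟨T₁, T₂, h⟩ := List.append_of_mem this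
      exact ⟨T₁.flatten, T₂.flatten, fun _ => by rw [h]; simp⟩
    · exact ⟨[], [], fun h => (hk h).elim⟩
  choose x z hxz using hpos
  -- Directories start with the entry for size 1, hence the shift to `i + 1`; 1 + 3n words precede
  -- the blocks.
  let off : Colour → ℕ → ℕ := fun c i => 1 + n + n + n + (x c (κ (i + 1))).length
  let H : List ℕ := [n] ++ List.ofFn (fun v => (par v : ℕ)) ++ (List.range n).map (off .white) ++
    (List.range n).map (off .black)
  have hH : H.length = 1 + n + n + n := by simp [H]; omega
  have hJlen : (H ++ T.flatten).length ≤ (56 * D + 60) * n := by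
    rw [List.length_append, hH]
    nlinarith
  refine ⟨par, H ++ T.flatten, hJlen, ?_, ?_, ?_⟩
  · simp [H]
  · intro v
    simp only [H, List.append_assoc, List.nil_append, List.cons_append, List.getElem?_cons_succ]
    rw [List.getElem?_append_left (by simp), List.getElem?_ofFn]
    simp
  · intro s hs₁ hs₂ c m hm
    obtain ⟨hk, hks₁, hks₂⟩ := hκ s hs₁ hs₂
    obtain ⟨o, ho, hans⟩ := hrec c (κ s) m (by omega)
    refine ⟨off c (s - 1), κ s, o, ?_, (hks _ hk).1, hks₁, hks₂, ?_, hans⟩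
    · cases c
      · simp only [directoryEntry]
        rw [List.getElem?_append_left (by omega),
          List.getElem?_append_right (by simp; omega), List.getElem?_map]
        simp only [List.length_append, List.length_singleton, List.length_ofFn, List.length_map,
          List.length_range]
        rw [List.getElem?_range (by omega), show n + n + s - (1 + n + n) = s - 1 by omega]
        rfl
      · simp only [directoryEntry, H]
        rw [List.getElem?_append_left (by simp; omega),
          List.getElem?_append_left (by simp; omega),
          List.getElem?_append_right (by simp; omega), List.getElem?_map]
        simp only [List.length_append, List.length_singleton, List.length_ofFn]
        rw [List.getElem?_range (by omega), show n + s - (1 + n) = s - 1 by omega]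
        rfl
    · have := ho.append (H ++ x c (κ s)) (z c (κ s))
      rw [List.length_append, hH, add_zero] at this
      have e : off c (s - 1) = 1 + n + n + n + (x c (κ s)).length := by
        simp only [off, Nat.sub_add_cancel hs₁]
      rw [e, hxz c _ hk]
      simpa only [List.append_assoc] using this

end Index

/-! ### The query program and its running time -/

namespace WordRAM

variable {w : ℕ}

/-- Started in `s`, the program `P` halts within `T` steps, having output `o`, with the memory and
the registers in `F` unchanged. -/
def Emits (F : Set ℕ) (P : Prog) (s : State w) (o : List (BitVec w)) (T : ℕ) : Prop :=
  ∃ s' t, Exec P s s' t ∧ t ≤ T ∧ s'.mem = s.mem ∧ (∀ r ∈ F, s'.reg r = s.reg r) ∧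
    s'.out = s.out ++ o

theorem Emits.mono {F F' : Set ℕ} {P : Prog} {s : State w} {o : List (BitVec w)} {T T' : ℕ}
    (h : Emits F P s o T) (hF : F' ⊆ F) (hT : T ≤ T') : Emits F' P s o T' := by
  obtain ⟨s', t, he, ht, hm, hr, ho⟩ := h
  exact ⟨s', t, he, ht.trans hT, hm, fun r h => hr r (hF h), ho⟩

theorem Emits.seq {F : Set ℕ} {P Q : Prog} {s : State w} {o o' : List (BitVec w)} {T T' : ℕ}
    (h : Emits F P s o T) (h' : ∀ s' : State w, s'.mem = s.mem → (∀ r ∈ F, s'.reg r = s.reg r) →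
      Emits F Q s' o' T') : Emits F (.seq P Q) s (o ++ o') (T + T') := by
  obtain ⟨s', t, he, ht, hm, hr, ho⟩ := h
  obtain ⟨s'', t', he', ht', hm', hr', ho'⟩ := h' s' hm hr
  exact ⟨s'', t + t', .seq he he', by omega, hm'.trans hm,
    fun r h => (hr' r h).trans (hr r h), by rw [ho', ho, List.append_assoc]⟩

theorem Emits.assign_seq {F : Set ℕ} {P : Prog} {s : State w} {o : List (BitVec w)} {T : ℕ}
    {r : ℕ} {e : Expr} (hr : r ∉ F)
    (h : Emits F P { s with reg := Function.update s.reg r (e.eval s) } o T) :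
    Emits F (.seq (.assign r e) P) s o (e.cost + 1 + T) := by
  obtain ⟨s', t, he, ht, hm, hr', ho⟩ := h
  refine ⟨s', _, .seq (.assign r e s) he, by omega, hm, fun r' h => ?_, ho⟩
  rw [hr' r' h]
  exact Function.update_of_ne (fun e : r' = r => hr (e ▸ h)) _ _

theorem ofNat_ne_zero {a : ℕ} (h₀ : a ≠ 0) (h : a < 2 ^ w) : BitVec.ofNat w a ≠ 0#w := by
  intro e
  have := congrArg BitVec.toNat e
  rw [BitVec.toNat_ofNat, Nat.mod_eq_of_lt h] at this
  simp at this
  exact h₀ this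

theorem ofNat_succ_sub_one (a : ℕ) :
    BitVec.ofNat w (a + 1) - BitVec.ofNat w 1 = BitVec.ofNat w a := by
  rw [BitVec.ofNat_add, BitVec.add_sub_cancel]

/-- The memory holds the numbers in `J`. -/
def Represents (J : List ℕ) (mem : BitVec w → BitVec w) : Prop :=
  ∀ i x : ℕ, J[i]? = some x → mem (BitVec.ofNat w i) = BitVec.ofNat w x

/-- Output as many consecutive memory words as register `7` says, from the address in
register `6` on. -/
def segmentLoop : Prog :=
  .loop (.reg 7) (.seq (.emit (.load (.reg 6))) (.seq (.assign 6 (.bin .add (.reg 6) (.lit 1)))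
    (.assign 7 (.bin .sub (.reg 7) (.lit 1)))))

/-- Addresses and contents may be taken modulo `2 ^ w` throughout; only the counter must be less
than `2 ^ w`, so that it vanishes exactly at the end. A round costs 2 for the test and 3 + 4 + 4 for
the body. -/
theorem emits_segmentLoop {F : Set ℕ} (h₆ : 6 ∉ F) (h₇ : 7 ∉ F) {J : List ℕ} :
    ∀ {l : List ℕ} {p : ℕ} {s : State w}, Represents J s.mem → StoredAt J p l →
      l.length < 2 ^ w → s.reg 6 = BitVec.ofNat w p → s.reg 7 = BitVec.ofNat w l.length →
      Emits F segmentLoop s (l.map (BitVec.ofNat w)) (2 + 13 * l.length) := by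
  intro l
  induction l with
  | nil =>
    intro p s _ _ _ _ hr
    exact ⟨s, _, Exec.loop_stop hr, by simp [Expr.cost], rfl, fun _ _ => rfl, by simp⟩
  | cons x l ih =>
    intro p s hJ hl hlen hp hr
    have hx : s.mem (BitVec.ofNat w p) = BitVec.ofNat w x := hJ _ _ (hl 0 (by simp))
    have hl' : StoredAt J (p + 1) l := fun i hi => by
      have := hl (i + 1) (by simpa using hi)
      rw [List.getElem?_cons_succ] at this
      rw [← this]
      congr 1
      omega
    let s₁ : State w := { s with out := s.out ++ [BitVec.ofNat w x] }
    let s₂ : State w := { s₁ with reg := Function.update s₁.reg 6 (BitVec.ofNat w (p + 1)) }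
    let s₃ : State w := { s₂ with reg := Function.update s₂.reg 7 (BitVec.ofNat w l.length) }
    obtain ⟨s', t, he, ht, hm, hr', ho⟩ := ih (p := p + 1) (s := s₃) hJ hl'
      (by simp at hlen; omega) (by simp [s₃, s₂]) (by simp [s₃])
    have e₁ : Exec (.emit (.load (.reg 6))) s s₁ 3 := by
      have := Exec.emit (.load (.reg 6)) s
      simp only [Expr.eval, hp, hx] at this
      exact this
    have e₂ : Exec (.assign 6 (.bin .add (.reg 6) (.lit 1))) s₁ s₂ 4 := by
      have := Exec.assign 6 (.bin .add (.reg 6) (.lit 1)) s₁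
      simp only [Expr.eval, Op.eval, s₁, hp, ← BitVec.ofNat_add] at this
      exact this
    have e₃ : Exec (.assign 7 (.bin .sub (.reg 7) (.lit 1))) s₂ s₃ 4 := by
      have := Exec.assign 7 (.bin .sub (.reg 7) (.lit 1)) s₂
      have h7 : s₂.reg 7 = BitVec.ofNat w (l.length + 1) := by
        simpa [s₂, s₁] using hr
      simp only [Expr.eval, Op.eval, h7, ofNat_succ_sub_one] at this
      exact this
    refine ⟨s', _, .loop_step ?_ (.seq e₁ (.seq e₂ e₃)) he, ?_, hm, ?_, ?_⟩
    · rw [Expr.eval, hr]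
      exact ofNat_ne_zero (by simp) hlen
    · simp only [Expr.cost, List.length_cons]
      omega
    · intro r h
      rw [hr' r h]
      have : r ≠ 6 := fun e => h₆ (e ▸ h)
      have : r ≠ 7 := fun e => h₇ (e ▸ h)
      simp [s₃, s₂, s₁, *]
    · simp [ho, s₃, s₂, s₁]

/-- Output as many successive ancestors of the node in register `6` as register `7` says. -/
def ancestorsLoop : Prog :=
  .loop (.reg 7) (.seq (.emit (.reg 6)) (.seq (.assign 6 (.load (.bin .add (.reg 6) (.lit 1))))
    (.assign 7 (.bin .sub (.reg 7) (.lit 1)))))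

theorem emits_ancestorsLoop {F : Set ℕ} (h₆ : 6 ∉ F) (h₇ : 7 ∉ F) {J : List ℕ} {n : ℕ}
    {par : Fin n → Fin n} (hpar : ∀ v : Fin n, J[(v : ℕ) + 1]? = some (par v : ℕ)) {k : ℕ} :
    ∀ {u : Fin n} {s : State w}, Represents J s.mem → k < 2 ^ w →
      s.reg 6 = BitVec.ofNat w u → s.reg 7 = BitVec.ofNat w k →
      Emits F ancestorsLoop s ((List.iterate par u k).map fun v : Fin n => BitVec.ofNat w v)
        (2 + 13 * k) := by
  induction k with
  | zero =>
    intro u s _ _ _ hr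
    exact ⟨s, _, Exec.loop_stop hr, by simp [Expr.cost], rfl, fun _ _ => rfl, by simp [List.iterate]⟩
  | succ k ih =>
    intro u s hJ hlen hp hr
    have hx : s.mem (BitVec.ofNat w (u + 1)) = BitVec.ofNat w (par u) := hJ _ _ (hpar u)
    let s₁ : State w := { s with out := s.out ++ [BitVec.ofNat w u] }
    let s₂ : State w := { s₁ with reg := Function.update s₁.reg 6 (BitVec.ofNat w (par u)) }
    let s₃ : State w := { s₂ with reg := Function.update s₂.reg 7 (BitVec.ofNat w k) }
    obtain ⟨s', t, he, ht, hm, hr', ho⟩ := ih (u := par u) (s := s₃) hJ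
      (by omega) (by simp [s₃, s₂]) (by simp [s₃])
    have e₁ : Exec (.emit (.reg 6)) s s₁ 2 := by
      have := Exec.emit (.reg 6) s
      simp only [Expr.eval, hp] at this
      exact this
    have e₂ : Exec (.assign 6 (.load (.bin .add (.reg 6) (.lit 1)))) s₁ s₂ 5 := by
      have := Exec.assign 6 (.load (.bin .add (.reg 6) (.lit 1))) s₁
      simp only [Expr.eval, Op.eval, s₁, hp, ← BitVec.ofNat_add, hx] at this
      exact this
    have e₃ : Exec (.assign 7 (.bin .sub (.reg 7) (.lit 1))) s₂ s₃ 4 := by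
      have := Exec.assign 7 (.bin .sub (.reg 7) (.lit 1)) s₂
      have h7 : s₂.reg 7 = BitVec.ofNat w (k + 1) := by
        simpa [s₂, s₁] using hr
      simp only [Expr.eval, Op.eval, h7, ofNat_succ_sub_one] at this
      exact this
    refine ⟨s', _, .loop_step ?_ (.seq e₁ (.seq e₂ e₃)) he, ?_, hm, ?_, ?_⟩
    · rw [Expr.eval, hr]
      exact ofNat_ne_zero (by simp) hlen
    · simp only [Expr.cost]
      omega
    · intro r h
      rw [hr' r h]
      have : r ≠ 6 := fun e => h₆ (e ▸ h)
      have : r ≠ 7 := fun e => h₇ (e ▸ h)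
      simp [s₃, s₂, s₁, *]
    · simp [ho, s₃, s₂, s₁, List.iterate]

/-- The word with number `i` of the record whose address is in register `5`. -/
def field (i : ℕ) : Expr := .load (.bin .add (.reg 5) (.lit i))

/-- Output the segment that is described by words `i` and `i + 1` of the record. -/
def emitSegment (i : ℕ) : Prog :=
  .seq (.assign 6 (.bin .add (.reg 4) (field i))) (.seq (.assign 7 (field (i + 1))) segmentLoop)

/-- Output the ancestors that are described by words `i` and `i + 1` of the record. -/
def emitAncestors (i : ℕ) : Prog :=
  .seq (.assign 6 (field i)) (.seq (.assign 7 (field (i + 1))) ancestorsLoop)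

theorem emits_emitSegment {J : List ℕ} {i a p : ℕ} {l : List ℕ} {s : State w} {base : ℕ}
    (hJ : Represents J s.mem) (h₄ : s.reg 4 = BitVec.ofNat w base)
    (h₅ : s.reg 5 = BitVec.ofNat w a) (hi : J[a + i]? = some p)
    (hi' : J[a + (i + 1)]? = some l.length) (hl : StoredAt J (base + p) l)
    (hlen : l.length < 2 ^ w) :
    Emits {4, 5} (emitSegment i) s (l.map (BitVec.ofNat w)) (14 + 13 * l.length) := by
  have e₁ := hJ _ _ hi
  have e₂ := hJ _ _ hi'
  rw [emitSegment]
  refine (Emits.assign_seq (by simp) (Emits.assign_seq (by simp)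
    (emits_segmentLoop (J := J) (l := l) (p := base + p) (by simp) (by simp) hJ hl hlen
      ?_ ?_))).mono subset_rfl ?_
  · simp [Expr.eval, Op.eval, field, h₄, h₅, ← BitVec.ofNat_add, e₁]
  · simp [Expr.eval, Op.eval, field, h₅, ← BitVec.ofNat_add, e₂]
  · simp only [Expr.cost, field]
    omega

theorem emits_emitAncestors {J : List ℕ} {n : ℕ}
    {par : Fin n → Fin n} (hpar : ∀ v : Fin n, J[(v : ℕ) + 1]? = some (par v : ℕ))
    {i a k : ℕ} {u : Fin n} {s : State w} (hJ : Represents J s.mem)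
    (h₅ : s.reg 5 = BitVec.ofNat w a) (hi : J[a + i]? = some (u : ℕ))
    (hi' : J[a + (i + 1)]? = some k) (hlen : k < 2 ^ w) :
    Emits {4, 5} (emitAncestors i) s ((List.iterate par u k).map fun v : Fin n => BitVec.ofNat w v)
      (12 + 13 * k) := by
  have e₁ := hJ _ _ hi
  have e₂ := hJ _ _ hi'
  rw [emitAncestors]
  refine (Emits.assign_seq (by simp) (Emits.assign_seq (by simp)
    (emits_ancestorsLoop (J := J) (u := u) (by simp) (by simp) hpar hJ hlen
      ?_ ?_))).mono subset_rfl ?_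
  · simp [Expr.eval, Op.eval, field, h₅, ← BitVec.ofNat_add, e₁]
  · simp [Expr.eval, Op.eval, field, h₅, ← BitVec.ofNat_add, e₂]
  · simp only [Expr.cost, field]
    omega

/-- Output the list that is described by the record whose address is in register `5`, in the block
whose address is in register `4`. -/
def emitRecord : Prog :=
  .seq (emitSegment 0) (.seq (emitAncestors 2) (.seq (emitAncestors 4) (emitSegment 6)))

theorem emits_emitRecord {J : List ℕ} {n : ℕ} {par : Fin n → Fin n}
    (hpar : ∀ v : Fin n, J[(v : ℕ) + 1]? = some (par v : ℕ)) {base m : ℕ} {o : List (Fin n)}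
    (ho : RecordAt par J base m o) (hlen : o.length < 2 ^ w) {s : State w}
    (hJ : Represents J s.mem) (h₄ : s.reg 4 = BitVec.ofNat w base)
    (h₅ : s.reg 5 = BitVec.ofNat w (base + 8 * m)) :
    Emits {4, 5} emitRecord s (o.map fun v : Fin n => BitVec.ofNat w v) (52 + 13 * o.length) := by
  obtain ⟨p₁, l₁, u₁, n₁, u₂, n₂, p₂, l₂, hr, h₁, h₂, rfl⟩ := ho
  simp only [List.length_append, List.length_iterate] at hlen
  have f := fun i (hi : i < 8) => hr i hi
  have key : Emits {4, 5} emitRecord s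
      ((l₁.map Fin.val).map (BitVec.ofNat w) ++
        (((List.iterate par u₁ n₁).map fun v : Fin n => BitVec.ofNat w v) ++
          (((List.iterate par u₂ n₂).map fun v : Fin n => BitVec.ofNat w v) ++
            (l₂.map Fin.val).map (BitVec.ofNat w))))
      (14 + 13 * (l₁.map Fin.val).length + (12 + 13 * n₁ + (12 + 13 * n₂ +
        (14 + 13 * (l₂.map Fin.val).length)))) := by
    refine (emits_emitSegment (i := 0) hJ h₄ h₅ (f 0 (by omega))
      (by rw [List.length_map]; exact f 1 (by omega)) h₁
      (by rw [List.length_map]; omega)).seq fun s₁ hm₁ hr₁ => ?_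
    rw [← hm₁] at hJ
    rw [← hr₁ 4 (by simp)] at h₄
    rw [← hr₁ 5 (by simp)] at h₅
    refine (emits_emitAncestors hpar (i := 2) hJ h₅ (f 2 (by omega)) (f 3 (by omega))
      (by omega)).seq fun s₂ hm₂ hr₂ => ?_
    rw [← hm₂] at hJ
    rw [← hr₂ 4 (by simp)] at h₄
    rw [← hr₂ 5 (by simp)] at h₅
    refine (emits_emitAncestors hpar (i := 4) hJ h₅ (f 4 (by omega)) (f 5 (by omega))
      (by omega)).seq fun s₃ hm₃ hr₃ => ?_
    rw [← hm₃] at hJ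
    rw [← hr₃ 4 (by simp)] at h₄
    rw [← hr₃ 5 (by simp)] at h₅
    exact emits_emitSegment (i := 6) hJ h₄ h₅ (f 6 (by omega))
      (by rw [List.length_map]; exact f 7 (by omega)) h₂ (by rw [List.length_map]; omega)
  have e : (l₁ ++ List.iterate par u₁ n₁ ++ List.iterate par u₂ n₂ ++ l₂).map
      (fun v : Fin n => BitVec.ofNat w v) = (l₁.map Fin.val).map (BitVec.ofNat w) ++
        (((List.iterate par u₁ n₁).map fun v : Fin n => BitVec.ofNat w v) ++
          (((List.iterate par u₂ n₂).map fun v : Fin n => BitVec.ofNat w v) ++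
            (l₂.map Fin.val).map (BitVec.ofNat w))) := by
    simp [Function.comp_def]
  rw [e]
  refine key.mono subset_rfl ?_
  simp only [List.length_append, List.length_iterate, List.length_map]
  omega

/-- The sum of the two input frequencies. -/
def totalExpr : Expr := .bin .add (.reg 0) (.reg 1)

/-- The position of the entry for the total frequency in the directory for the colour `c`. -/
def directoryExpr : Colour → Expr
  | .white => .bin .add (.load (.lit 0)) totalExpr
  | .black => .bin .add (.bin .add (.load (.lit 0)) (.load (.lit 0))) totalExpr

/-- The register that holds the input frequency of the colour. -/
def inputReg : Colour → ℕ
  | .black => 0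
  | .white => 1

/-- Answer a query in which `c` is the less frequent colour. -/
def answer (c : Colour) : Prog :=
  .seq (.assign 4 (.load (directoryExpr c)))
    (.seq (.assign 5 (.bin .add (.reg 4) (.bin .mul (.lit 8) (.reg (inputReg c))))) emitRecord)

/-- The query program. -/
def query : Prog :=
  .ite (.bin .lt (.load (.lit 0)) (.reg 0)) .nop
    (.ite (.bin .lt (.load (.lit 0)) (.reg 1)) .nop
      (.ite (.bin .lt (.load (.lit 0)) totalExpr) .nop
        (.ite (.bin .lt (.reg 0) (.reg 1)) (answer .black) (answer .white))))

theorem emits_answer {J : List ℕ} {n : ℕ} {par : Fin n → Fin n}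
    (hpar : ∀ v : Fin n, J[(v : ℕ) + 1]? = some (par v : ℕ)) (hn : J[0]? = some n)
    {base m a b : ℕ} {o : List (Fin n)} {c : Colour}
    (hdir : J[directoryEntry n c (a + b)]? = some base)
    (ho : RecordAt par J base m o) (hlen : o.length < 2 ^ w) {s : State w}
    (hJ : Represents J s.mem) (h₀ : s.reg 0 = BitVec.ofNat w a) (h₁ : s.reg 1 = BitVec.ofNat w b)
    (hm : s.reg (inputReg c) = BitVec.ofNat w m) :
    Emits ∅ (answer c) s (o.map fun v : Fin n => BitVec.ofNat w v) (69 + 13 * o.length) := by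
  have e₁ := hJ _ _ hdir
  have e₀ := hJ _ _ hn
  have hc : inputReg c ≠ 4 := by cases c <;> simp [inputReg]
  have hadd : (directoryExpr c).eval s = BitVec.ofNat w (directoryEntry n c (a + b)) := by
    cases c <;>
      simp [directoryExpr, directoryEntry, totalExpr, Expr.eval, Op.eval, h₀, h₁, e₀,
        BitVec.ofNat_add]
  have hcost : (directoryExpr c).cost ≤ 9 := by
    cases c <;> simp [directoryExpr, totalExpr, Expr.cost]
  rw [answer]
  refine (Emits.assign_seq (by simp) (Emits.assign_seq (by simp)
    ((emits_emitRecord hpar ho hlen ?_ ?_ ?_).mono (by simp) le_rfl))).mono subset_rfl ?_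
  · exact hJ
  · simp [Expr.eval, hadd, e₁]
  · simp [Expr.eval, Op.eval, hadd, e₁, hm, hc, BitVec.ofNat_add, BitVec.ofNat_mul]
  · simp only [Expr.cost]
    omega

theorem Emits.nop {F : Set ℕ} {s : State w} : Emits F .nop s [] 1 :=
  ⟨s, 1, .nop s, le_rfl, rfl, fun _ _ => rfl, by simp⟩

/-- A conditional on a comparison, if its left branch emits `o` whenever the comparison holds, and
its right branch emits `o` whenever it does not. -/
theorem Emits.ite_lt {F : Set ℕ} {P Q : Prog} {s : State w} {o : List (BitVec w)} {T : ℕ}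
    {e₁ e₂ : Expr} {x y : ℕ} (h₁ : e₁.eval s = BitVec.ofNat w x)
    (h₂ : e₂.eval s = BitVec.ofNat w y) (hx : x < 2 ^ w) (hy : y < 2 ^ w) (hw : 1 < 2 ^ w)
    (hP : x < y → Emits F P s o T) (hQ : y ≤ x → Emits F Q s o T) :
    Emits F (.ite (.bin .lt e₁ e₂) P Q) s o (e₁.cost + e₂.cost + 2 + T) := by
  have hev : (Expr.bin .lt e₁ e₂).eval s = if x < y then 1#w else 0#w := by
    simp only [Expr.eval, Op.eval, h₁, h₂, BitVec.toNat_ofNat, Nat.mod_eq_of_lt hx,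
      Nat.mod_eq_of_lt hy]
  by_cases h : x < y
  · obtain ⟨s', t, he, ht, hr⟩ := hP h
    refine ⟨s', _, .ite_true ?_ he, ?_, hr⟩
    · rw [hev, if_pos h]
      exact ofNat_ne_zero one_ne_zero hw
    · simp only [Expr.cost]
      omega
  · obtain ⟨s', t, he, ht, hr⟩ := hQ (by omega)
    refine ⟨s', _, .ite_false ?_ he, ?_, hr⟩
    · rw [hev, if_neg h]
    · simp only [Expr.cost]
      omega

end WordRAM

/-! ### From stored answers to correct output -/

theorem Multiset.card_eq_count_add_count (M : Multiset Colour) :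
    M.card = M.count .black + M.count .white := by
  induction M using Multiset.induction with
  | empty => simp
  | cons c M ih => cases c <;> simp [ih] <;> omega

/-- Both totals lie in an interval of length x = ⌊k/D⌋ and share the minority count `m`, so `h` and
`b` differ by at most x. Since Dx ≤ k ≤ b + m ≤ 2b, the choice of `D` gives (1 + ε)x ≤ εb, which
yields both inequalities. -/
theorem withinFactor_of_scale {ε : ℝ} (hε : 0 < ε) {D : ℕ} (hD : 2 * (1 + ε) ≤ ε * D)
    {h b m k : ℕ} (hk : k ≤ b + m) (hk' : b + m ≤ k + k / D) (hh : k ≤ h + m)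
    (hh' : h + m ≤ k + k / D) (hm : m ≤ b) : WithinFactor ε h b := by
  obtain ⟨x, hx⟩ : ∃ x, x = k / D := ⟨_, rfl⟩
  have hDx : D * x ≤ 2 * b := by
    rw [hx]
    exact (Nat.mul_div_le k D).trans (by omega)
  rw [← hx] at hk' hh'
  have h₁ : h ≤ b + x := by omega
  have h₂ : b ≤ h + x := by omega
  have hDx' : (D : ℝ) * x ≤ 2 * b := by exact_mod_cast hDx
  have h₁' : (h : ℝ) ≤ b + x := by exact_mod_cast h₁
  have h₂' : (b : ℝ) ≤ h + x := by exact_mod_cast h₂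
  have hDpos : (0 : ℝ) < D := by
    by_contra hcon
    nlinarith
  have key : (1 + ε) * x ≤ ε * b := by
    have : D * ((1 + ε) * x) ≤ D * (ε * (b : ℝ)) := by
      nlinarith [mul_le_mul_of_nonneg_left hDx' (by linarith : 0 ≤ 1 + ε),
        mul_le_mul_of_nonneg_right hD (Nat.cast_nonneg b : (0 : ℝ) ≤ b)]
    exact le_of_mul_le_mul_left this hDpos
  have hx0 : (0 : ℝ) ≤ ε * x := by positivity
  constructor
  · nlinarith
  · nlinarith

theorem withinFactor_self {ε : ℝ} (hε : 0 < ε) (a : ℕ) : WithinFactor ε a a := by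
  have : (0 : ℝ) ≤ ε * a := by positivity
  constructor <;> linarith

/-- The other colour. -/
def Colour.other : Colour → Colour
  | .black => .white
  | .white => .black

theorem Multiset.card_eq_count_add_count_other (M : Multiset Colour) (c : Colour) :
    M.card = M.count c + M.count c.other := by
  rw [M.card_eq_count_add_count]
  cases c
  · rfl
  · exact add_comm _ _

theorem Colour.eq_or_eq_other (c d : Colour) : d = c ∨ d = c.other := by
  cases c <;> cases d <;> simp [Colour.other]

/-- An exact match has size |M|, which lies in the interval, and count `M.count c`; so an empty
answer rules it out. -/
theorem IsAnswer.correctOutput {n w : ℕ} {G : SimpleGraph (Fin n)} {colour : Fin n → Colour}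
    {ε : ℝ} (hε : 0 < ε) {D : ℕ} (hD : 2 * (1 + ε) ≤ ε * D) {M : Multiset Colour} {c : Colour}
    (hc : M.count c ≤ M.count c.other) {k : ℕ} (hk : k ≤ M.card) (hk' : M.card ≤ k + k / D)
    {o : List (Fin n)} (ho : IsAnswer G colour c k (k + k / D) (M.count c) o) :
    CorrectOutput G colour ε M (o.map fun v : Fin n => BitVec.ofNat w v) := by
  have hcard : ∀ S : Finset (Fin n), (colourMultiset colour S).card = S.card := by
    simp [colourMultiset]
  rcases ho with ⟨rfl, h⟩ | ⟨hn, hconn, hol, hou, hcount⟩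
  · refine Or.inr ⟨rfl, ?_⟩
    rintro ⟨S, hS, rfl⟩
    rw [hcard] at hk hk'
    exact h S hS hk hk' rfl
  · refine Or.inl ⟨o, hn, by simp [← List.map_eq_flatMap], hconn, fun d => ?_⟩
    have h₁ : (colourMultiset colour o.toFinset).count c = M.count c := by
      rw [count_colourMultiset_toFinset colour c hn, hcount]
    rcases c.eq_or_eq_other d with rfl | rfl
    · rw [h₁]
      exact withinFactor_self hε _
    · have h₂ := (colourMultiset colour o.toFinset).card_eq_count_add_count_other c
      rw [hcard, List.toFinset_card_of_nodup hn, h₁] at h₂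
      have h₃ := M.card_eq_count_add_count_other c
      exact withinFactor_of_scale hε hD (m := M.count c) (k := k) (by omega) (by omega) (by omega)
        (by omega) hc

theorem correctOutput_nil {n w : ℕ} {G : SimpleGraph (Fin n)} {colour : Fin n → Colour}
    {ε : ℝ} {M : Multiset Colour} (hM : n < M.card) :
    CorrectOutput G colour ε M ([] : List (BitVec w)) := by
  refine Or.inr ⟨rfl, ?_⟩
  rintro ⟨S, -, rfl⟩
  have := S.card_le_univ
  simp [colourMultiset] at hM this
  omega

/-! ### Assembling the theorem -/

open WordRAM

theorem theorem3 (ε : ℝ) (hε : 0 < ε) :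
    ∃ (P : WordRAM.Prog) (cSpace cTime K : ℕ),
      ∀ (n w : ℕ), K * n ≤ 2 ^ w →
      ∀ (G : SimpleGraph (Fin n)) (colour : Fin n → Colour), G.IsTree →
      ∃ I : List (BitVec w), I.length ≤ cSpace * n ∧ I.length ≤ 2 ^ w ∧
        ∀ M : Multiset Colour, M ≠ 0 → (∀ c : Colour, M.count c < 2 ^ w) →
          AnswersQuery P I G colour ε M (cTime * M.card) := by
  obtain ⟨D, hD⟩ := exists_nat_ge (2 * (1 + ε) / ε)
  rw [div_le_iff₀' hε] at hD
  have hDpos : 0 < D := by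
    rcases Nat.eq_zero_or_pos D with rfl | h
    · simp at hD
      linarith
    · exact h
  -- `K` equals the space constant, so the index fits into memory. The time is at most 90 + 13 ·
  -- 2|M| ≤ 130|M|.
  refine ⟨query, 56 * D + 60, 130, 56 * D + 60, fun n w hw G colour hG => ?_⟩
  obtain ⟨par, J, hlen, hn, hpar, hrec⟩ := exists_index hG colour D hDpos
  have hn1 : 1 ≤ n := by
    obtain ⟨v⟩ := hG.connected.nonempty
    exact v.pos
  have hnw : 60 * n ≤ 2 ^ w := by nlinarith
  refine ⟨J.map (BitVec.ofNat w), by rwa [List.length_map], by rw [List.length_map]; omega,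
    fun M hM hMw s hI h₀ h₁ hout => ?_⟩
  have hJ : Represents J s.mem := by
    intro i x hx
    obtain ⟨hi, rfl⟩ := List.getElem?_eq_some_iff.1 hx
    rw [hI i (by rwa [List.length_map]), List.getElem_map]
  have hcard := M.card_eq_count_add_count
  have hMpos : 0 < M.card := Multiset.card_pos.2 hM
  have e₀ : (Expr.load (.lit 0)).eval s = BitVec.ofNat w n := hJ _ _ hn
  obtain ⟨o, hem, hcorrect⟩ : ∃ o, Emits ∅ query s o (130 * M.card) ∧
      CorrectOutput G colour ε M o := by
    -- The sum of the frequencies may wrap around. It is computed only after each frequency has been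
    -- found to be at most `n`, and then it is at most 2n < `2 ^ w`.
    by_cases hMn : n < M.card
    · refine ⟨[], ?_, correctOutput_nil hMn⟩
      refine Emits.mono (Emits.ite_lt (T := 20) e₀ h₀ (by omega) (hMw _) (by omega)
        (fun _ => Emits.nop.mono subset_rfl (by omega)) fun hb => ?_) subset_rfl
        (by simp only [Expr.cost]; omega)
      refine Emits.mono (Emits.ite_lt (T := 10) e₀ h₁ (by omega) (hMw _) (by omega)
        (fun _ => Emits.nop.mono subset_rfl (by omega)) fun hw => ?_) subset_rfl
        (by simp only [Expr.cost]; omega)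
      refine Emits.mono (Emits.ite_lt (T := 1) (y := M.count .black + M.count .white) e₀ ?_
        (by omega) (by omega) (by omega) (fun _ => Emits.nop) fun h => by omega) subset_rfl
        (by simp only [Expr.cost, totalExpr]; omega)
      simp only [totalExpr, Expr.eval, Op.eval, h₀, h₁, BitVec.ofNat_add]
    · have hm : ∀ c, M.count c ≤ M.card := fun c => M.count_le_card c
      obtain ⟨c, hc, hcc⟩ : ∃ c, M.count c ≤ M.count c.other ∧
          (M.count .black < M.count .white ∧ c = .black ∨
            M.count .white ≤ M.count .black ∧ c = .white) := by
        rcases lt_or_ge (M.count .black) (M.count .white) with h | h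
        · exact ⟨.black, h.le, Or.inl ⟨h, rfl⟩⟩
        · exact ⟨.white, h, Or.inr ⟨h, rfl⟩⟩
      obtain ⟨base, k, o, hdir, hk₀, hk, hk', hro, hans⟩ :=
        hrec M.card hMpos (by omega) c (M.count c) (hm c)
      refine ⟨_, ?_, hans.correctOutput hε hD hc hk hk'⟩
      -- The size of the answer is at most k + k/D ≤ 2k, and k ≤ |M|.
      have hol : o.length ≤ 2 * M.card := by
        have h₂ := hans.length_le
        have h₃ := Nat.div_le_self k D
        omega
      rw [hcard] at hdir
      have hin : s.reg (inputReg c) = BitVec.ofNat w (M.count c) := by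
        cases c
        · exact h₀
        · exact h₁
      have hanswer := emits_answer hpar hn hdir hro (by omega) hJ h₀ h₁ hin
      refine Emits.mono (Emits.ite_lt (T := 85 + 13 * o.length) e₀ h₀ (by omega) (hMw _) (by omega)
        (fun h => by have := hm .black; omega) fun _ => ?_) subset_rfl
        (by simp only [Expr.cost]; omega)
      refine Emits.mono (Emits.ite_lt (T := 80 + 13 * o.length) e₀ h₁ (by omega) (hMw _) (by omega)
        (fun h => by have := hm .white; omega) fun _ => ?_) subset_rfl
        (by simp only [Expr.cost]; omega)
      refine Emits.mono (Emits.ite_lt (T := 73 + 13 * o.length)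
        (y := M.count .black + M.count .white) e₀ ?_
        (by omega) (by omega) (by omega) (fun h => by omega) fun _ => ?_) subset_rfl
        (by simp only [Expr.cost, totalExpr]; omega)
      · simp only [totalExpr, Expr.eval, Op.eval, h₀, h₁, BitVec.ofNat_add]
      refine Emits.mono (Emits.ite_lt (T := 69 + 13 * o.length) (e₁ := .reg 0) (e₂ := .reg 1)
        h₀ h₁ (hMw _) (hMw _) (by omega) (fun h => ?_) fun h => ?_) subset_rfl
        (by simp only [Expr.cost]; omega)
      · obtain ⟨-, rfl⟩ | ⟨h', -⟩ := hcc
        · exact hanswer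
        · omega
      · obtain ⟨h', -⟩ | ⟨-, rfl⟩ := hcc
        · omega
        · exact hanswer
  obtain ⟨s', t, hex, ht, hmem, -, ho⟩ := hem
  refine ⟨s', t, hex, ht, fun i hi => by rw [hmem]; exact hI i hi, ?_⟩
  rw [ho, hout, List.nil_append]
  exact hcorrect
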